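/- Let $*$ be a continuous t-norm on $[0,1]$, that is, a continuous map $*\colon[0,1]\times[0,1]\to[0,1]$ that is monotone in each argument and makes $([0,1],*,1)$ a commutative monoid. Let $p\to r=\max\{q\in[0,1]\mid p*q\le r\}$ be its residuum. A $[0,1]_*$-set is a set $X$ with a map $\alpha\colon X\times X\to[0,1]$ such that for all $x,y,z\in X$: $\alpha(x,y)\le\alpha(x,x)\wedge\alpha(y,y)$; $\alpha(x,y)=\alpha(y,x)$; and $\alpha(y,z)*(\alpha(y,y)\to\alpha(x,y))\le\alpha(x,z)$. A morphism $(X,\alpha)\to(Y,\beta)$ of $[0,1]_*$-sets is a map $\phi\colon X\times Y\to[0,1]$ such that for all $x,x'\in X$ and $y,y'\in Y$: 1. $\phi(x,y)\le\alpha(x,x)\wedge\beta(y,y)$, 2. $(\beta(y,y)\to\beta(y,y'))*\phi(x,y)*(\alpha(x,x)\to\alpha(x',x))\le\phi(x',y')$, 3. $\phi(x,y')*(\alpha(x,x)\to\phi(x,y))\le\beta(y,y')$, 4. $\alpha(x,x')\le\bigvee_{y\in Y}\phi(x',y)*(\beta(y,y)\to\phi(x,y))$ (conditions 1 and 2 say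 that $\phi$ is a $\mathsf{D}[0,1]_*$-distributor, conditions 3 and 4 that it is left adjoint to its transpose). The composite of $\phi\colon(X,\alpha)\to(Y,\beta)$ and $\psi\colon(Y,\beta)\to(Z,\gamma)$ is $$(\psi\circ\phi)(x,z)=\bigvee_{y\in Y}\psi(y,z)*(\beta(y,y)\to\phi(x,y)),$$ and the identity morphism of $(X,\alpha)$ is $\alpha$. Let $[0,1]_*\text{-}\mathbf{Set}$ be the resulting category. Then $[0,1]_*\text{-}\mathbf{Set}$ is cartesian closed (it has finite products, and for every object $Y$ the functor $-\times Y$ has a right adjoint) if and only if $*$ is the minimum t-norm, $p*q=\min\{p,q\}$ for all $p,q\in[0,1]$. -/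

import Mathlib

open CategoryTheory
open scoped unitInterval

universe u v

/-- A continuous t-norm on the unit interval `I = [0,1]`. -/
@[ext]
structure ContinuousTNorm where
  op : I → I → I
  assoc : ∀ p q r, op (op p q) r = op p (op q r)
  comm : ∀ p q, op p q = op q p
  one_op : ∀ p, op 1 p = p
  mono : ∀ p p' q q', p ≤ p' → q ≤ q' → op p q ≤ op p' q'
  cont : Continuous fun x : I × I => op x.1 x.2

namespace ContinuousTNorm

variable (T : ContinuousTNorm)

/-- The residuum `p → r`, the largest `q` with `p * q ≤ r` (see `op_le_iff`). -/
noncomputable def imp (p r : I) : I := sSup {q | T.op p q ≤ r}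

/-- The minimum t-norm. -/
def minimum : ContinuousTNorm where
  op p q := p ⊓ q
  assoc := inf_assoc
  comm := inf_comm
  one_op p := inf_eq_right.2 p.2.2
  mono _ _ _ _ := inf_le_inf
  cont := by fun_prop

lemma op_one (p : I) : T.op p 1 = p := by rw [T.comm, T.one_op]

lemma op_zero (p : I) : T.op p 0 = 0 :=
  le_antisymm (by simpa [T.one_op] using T.mono p 1 0 0 p.2.2 le_rfl) (T.op p 0).2.1

lemma op_left (p : I) {q r : I} (h : q ≤ r) : T.op p q ≤ T.op p r := T.mono _ _ _ _ le_rfl h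

lemma op_right (p : I) {q r : I} (h : q ≤ r) : T.op q p ≤ T.op r p := T.mono _ _ _ _ h le_rfl

lemma op_le_left (p q : I) : T.op p q ≤ p := by
  simpa [T.op_one] using T.op_left p (show q ≤ 1 from q.2.2)

lemma op_le_right (p q : I) : T.op p q ≤ q := by rw [T.comm]; exact T.op_le_left q p

lemma op_left_comm (p q r : I) : T.op p (T.op q r) = T.op q (T.op p r) := by
  rw [← T.assoc, T.comm p q, T.assoc]

lemma cont_left (p : I) : Continuous (T.op p) :=
  T.cont.comp (continuous_const.prodMk continuous_id)

lemma op_le_iff (p q r : I) : T.op p q ≤ r ↔ q ≤ T.imp p r := by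
  constructor
  · intro h
    exact le_sSup h
  · intro h
    have hc : IsClosed {q | T.op p q ≤ r} := isClosed_le (T.cont_left p) continuous_const
    have hm : T.imp p r ∈ {q | T.op p q ≤ r} :=
      hc.sSup_mem ⟨0, (T.op_zero p).trans_le r.2.1⟩
    exact (T.op_left p h).trans hm

lemma op_imp_le (p r : I) : T.op p (T.imp p r) ≤ r := (T.op_le_iff _ _ _).2 le_rfl

lemma op_imp {q w : I} (h : w ≤ q) : T.op q (T.imp q w) = w := by
  refine le_antisymm (T.op_imp_le q w) ?_
  have hmem : w ∈ Set.Icc (T.op q 0) (T.op q 1) := by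
    rw [T.op_zero, T.op_one]
    exact ⟨w.2.1, h⟩
  obtain ⟨t, ht⟩ := intermediate_value_univ 0 1 (T.cont_left q) hmem
  rw [← ht]
  exact T.op_left q ((T.op_le_iff _ _ _).1 le_rfl)

lemma imp_self (p : I) : T.imp p p = 1 :=
  le_antisymm (T.imp p p).2.2 ((T.op_le_iff _ _ _).1 (by rw [T.op_one]))

lemma imp_mono (p : I) {q r : I} (h : q ≤ r) : T.imp p q ≤ T.imp p r :=
  (T.op_le_iff _ _ _).1 ((T.op_imp_le p q).trans h)

lemma imp_op_le (p q r : I) : T.op (T.imp p q) r ≤ T.imp p (T.op q r) := by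
  rw [← T.op_le_iff, ← T.assoc]
  exact T.op_right r (T.op_imp_le p q)

lemma swap {q a b : I} (ha : a ≤ q) (hb : b ≤ q) :
    T.op b (T.imp q a) = T.op (T.imp q b) a := by
  conv_lhs => rw [← T.op_imp hb]
  conv_rhs => rw [← T.op_imp ha]
  rw [T.assoc, T.op_left_comm]

lemma op_iSup {ι : Sort v} (p : I) (f : ι → I) : T.op p (⨆ i, f i) = ⨆ i, T.op p (f i) :=
  (show GaloisConnection (T.op p) (T.imp p) from T.op_le_iff p).l_iSup

lemma iSup_op {ι : Sort v} (p : I) (f : ι → I) : T.op (⨆ i, f i) p = ⨆ i, T.op (f i) p := by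
  simp only [T.comm _ p, op_iSup]

end ContinuousTNorm

/-- A `[0,1]_*`-valued set: a set with a `[0,1]_*`-valued equality `eq`. -/
structure ValuedSet (T : ContinuousTNorm) where
  carrier : Type u
  eq : carrier → carrier → I
  le_extent : ∀ x y, eq x y ≤ eq x x ⊓ eq y y
  symm : ∀ x y, eq x y = eq y x
  trans : ∀ x y z, T.op (eq y z) (T.imp (eq y y) (eq x y)) ≤ eq x z

namespace ValuedSet

variable {T : ContinuousTNorm}

/-- A morphism of `[0,1]_*`-sets. The fields `le_extent` and `compat` say that `rel` is a
`D[0,1]_*`-distributor; `functional` and `total` are the counit and the unit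
of the adjunction between `rel` and its transpose. -/
@[ext]
structure Hom (X Y : ValuedSet.{u} T) where
  rel : X.carrier → Y.carrier → I
  le_extent : ∀ x y, rel x y ≤ X.eq x x ⊓ Y.eq y y
  compat : ∀ x x' y y', T.op (T.op (T.imp (Y.eq y y) (Y.eq y y')) (rel x y))
    (T.imp (X.eq x x) (X.eq x' x)) ≤ rel x' y'
  functional : ∀ x y y', T.op (rel x y') (T.imp (X.eq x x) (rel x y)) ≤ Y.eq y y'
  total : ∀ x x', X.eq x x' ≤ ⨆ y, T.op (rel x' y) (T.imp (Y.eq y y) (rel x y))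

lemma eq_le_left (X : ValuedSet.{u} T) (x y : X.carrier) : X.eq x y ≤ X.eq x x :=
  (X.le_extent x y).trans inf_le_left

lemma eq_le_right (X : ValuedSet.{u} T) (x y : X.carrier) : X.eq x y ≤ X.eq y y :=
  (X.le_extent x y).trans inf_le_right

namespace Hom

lemma le_left {X Y : ValuedSet.{u} T} (f : Hom X Y) (x : X.carrier) (y : Y.carrier) :
    f.rel x y ≤ X.eq x x := (f.le_extent x y).trans inf_le_left

lemma le_right {X Y : ValuedSet.{u} T} (f : Hom X Y) (x : X.carrier) (y : Y.carrier) :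
    f.rel x y ≤ Y.eq y y := (f.le_extent x y).trans inf_le_right

lemma compat_left {X Y : ValuedSet.{u} T} (f : Hom X Y) (x x' : X.carrier) (y : Y.carrier) :
    T.op (f.rel x y) (T.imp (X.eq x x) (X.eq x' x)) ≤ f.rel x' y := by
  simpa [T.imp_self, T.one_op] using f.compat x x' y y

lemma compat_right {X Y : ValuedSet.{u} T} (f : Hom X Y) (x : X.carrier) (y y' : Y.carrier) :
    T.op (T.imp (Y.eq y y) (Y.eq y y')) (f.rel x y) ≤ f.rel x y' := by
  simpa [T.imp_self, T.op_one] using f.compat x x y y'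

/-- The identity morphism is the equality itself. -/
def id (X : ValuedSet.{u} T) : Hom X X where
  rel := X.eq
  le_extent := X.le_extent
  compat x x' y y' := by
    rw [T.assoc]
    refine (T.op_left _ (X.trans x' x y)).trans ?_
    rw [← T.swap (X.eq_le_right x' y) (X.eq_le_left y y')]
    exact X.trans x' y y'
  functional x y y' := by
    rw [X.symm x y]
    exact X.trans y x y'
  total x x' := by
    refine le_trans ?_ (le_iSup _ x')
    rw [T.op_imp (X.eq_le_right x x')]

/-- The composite `ψ ∘ φ` of `φ : X ⇸ Y` and `ψ : Y ⇸ Z`, as a relation. -/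
noncomputable def compRel {X Y Z : ValuedSet.{u} T} (φ : Hom X Y) (ψ : Hom Y Z)
    (x : X.carrier) (z : Z.carrier) : I :=
  ⨆ y, T.op (ψ.rel y z) (T.imp (Y.eq y y) (φ.rel x y))

lemma compRel_eq {X Y Z : ValuedSet.{u} T} (φ : Hom X Y) (ψ : Hom Y Z)
    (x : X.carrier) (z : Z.carrier) :
    compRel φ ψ x z = ⨆ y, T.op (T.imp (Y.eq y y) (ψ.rel y z)) (φ.rel x y) := by
  unfold compRel
  congr 1
  funext y
  exact T.swap (φ.le_right x y) (ψ.le_left y z)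

lemma compRel_le_left {X Y Z : ValuedSet.{u} T} (φ : Hom X Y) (ψ : Hom Y Z)
    (x : X.carrier) (z : Z.carrier) : compRel φ ψ x z ≤ X.eq x x := by
  rw [compRel_eq]
  exact iSup_le fun y => (T.op_le_right _ _).trans (φ.le_left x y)

lemma compRel_le_right {X Y Z : ValuedSet.{u} T} (φ : Hom X Y) (ψ : Hom Y Z)
    (x : X.carrier) (z : Z.carrier) : compRel φ ψ x z ≤ Z.eq z z :=
  iSup_le fun y => (T.op_le_left _ _).trans (ψ.le_right y z)

lemma compRel_functional {X Y Z : ValuedSet.{u} T} (φ : Hom X Y) (ψ : Hom Y Z)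
    (x : X.carrier) (z z' : Z.carrier) :
    T.op (compRel φ ψ x z') (T.imp (X.eq x x) (compRel φ ψ x z)) ≤ Z.eq z z' := by
  rw [T.swap (compRel_le_left φ ψ x z) (compRel_le_left φ ψ x z'), compRel_eq φ ψ x z, T.op_iSup]
  refine iSup_le fun y => ?_
  rw [T.op_left_comm, ← T.swap (φ.le_left x y) (compRel_le_left φ ψ x z'), compRel_eq φ ψ x z',
    T.iSup_op, T.op_iSup]
  refine iSup_le fun y' => ?_
  rw [T.assoc]
  refine (T.op_left _ (T.op_left _ (φ.functional x y y'))).trans ?_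
  rw [← T.swap (Y.eq_le_right y y') (ψ.le_left y' z')]
  refine (T.op_left _ (ψ.compat_left y' y z')).trans ?_
  rw [T.comm]
  exact ψ.functional y z z'

lemma compRel_total {X Y Z : ValuedSet.{u} T} (φ : Hom X Y) (ψ : Hom Y Z) (x x' : X.carrier) :
    X.eq x x' ≤ ⨆ z, T.op (compRel φ ψ x' z) (T.imp (Z.eq z z) (compRel φ ψ x z)) := by
  refine (φ.total x x').trans (iSup_le fun y => ?_)
  have h1 : T.op (φ.rel x' y) (T.imp (Y.eq y y) (φ.rel x y)) =
      T.op (T.op (T.imp (Y.eq y y) (φ.rel x' y)) (T.imp (Y.eq y y) (φ.rel x y))) (Y.eq y y) := by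
    conv_lhs => rw [← T.op_imp (φ.le_right x' y)]
    rw [T.assoc, T.comm]
  rw [h1]
  refine (T.op_left _ (ψ.total y y)).trans ?_
  rw [T.op_iSup]
  refine iSup_mono fun z => ?_
  have h2 : T.op (T.op (T.imp (Y.eq y y) (φ.rel x' y)) (T.imp (Y.eq y y) (φ.rel x y)))
      (T.op (ψ.rel y z) (T.imp (Z.eq z z) (ψ.rel y z))) =
      T.op (T.op (ψ.rel y z) (T.imp (Y.eq y y) (φ.rel x' y)))
        (T.op (T.imp (Z.eq z z) (ψ.rel y z)) (T.imp (Y.eq y y) (φ.rel x y))) := by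
    simp only [T.assoc, T.comm, T.op_left_comm]
  rw [h2]
  refine T.mono _ _ _ _ (le_iSup (fun y => T.op (ψ.rel y z) (T.imp (Y.eq y y) (φ.rel x' y))) y) ?_
  refine (T.imp_op_le _ _ _).trans (T.imp_mono _ ?_)
  exact le_iSup (fun y => T.op (ψ.rel y z) (T.imp (Y.eq y y) (φ.rel x y))) y

/-- Composition of morphisms, in diagrammatic order. -/
noncomputable def comp {X Y Z : ValuedSet.{u} T} (φ : Hom X Y) (ψ : Hom Y Z) : Hom X Z where
  rel := compRel φ ψ
  le_extent x z := le_inf (compRel_le_left φ ψ x z) (compRel_le_right φ ψ x z)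
  compat x x' z z' := by
    rw [compRel, T.op_iSup, T.iSup_op]
    refine iSup_mono fun y => ?_
    rw [← T.assoc, T.assoc]
    refine T.mono _ _ _ _ (ψ.compat_right y z z') ?_
    exact (T.imp_op_le _ _ _).trans (T.imp_mono _ (φ.compat_left x x' y))
  functional := compRel_functional φ ψ
  total := compRel_total φ ψ

lemma id_comp {X Y : ValuedSet.{u} T} (φ : Hom X Y) : comp (id X) φ = φ := by
  ext x y : 3
  refine le_antisymm (iSup_le fun x' => φ.compat_left x' x y) ?_
  refine le_trans ?_ (le_iSup _ x)
  simp only [id, T.imp_self, T.op_one]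
  exact le_rfl

lemma comp_id {X Y : ValuedSet.{u} T} (φ : Hom X Y) : comp φ (id Y) = φ := by
  ext x y : 3
  change compRel φ (id Y) x y = _
  rw [compRel_eq]
  refine le_antisymm (iSup_le fun y' => φ.compat_right x y' y) ?_
  refine le_trans ?_ (le_iSup _ y)
  simp only [id, T.imp_self, T.one_op]
  exact le_rfl

lemma comp_assoc {W X Y Z : ValuedSet.{u} T} (φ : Hom W X) (ψ : Hom X Y) (χ : Hom Y Z) :
    comp (comp φ ψ) χ = comp φ (comp ψ χ) := by
  ext w z : 3
  change compRel (comp φ ψ) χ w z = compRel φ (comp ψ χ) w z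
  rw [compRel_eq]
  simp only [compRel, comp, T.op_iSup, T.iSup_op]
  rw [iSup_comm]
  congr 1
  funext x
  congr 1
  funext y
  rw [← T.assoc, ← T.swap (ψ.le_right x y) (χ.le_left y z)]

end Hom

/-- The category `[0,1]_*-Set`. -/
noncomputable instance : LargeCategory (ValuedSet.{u} T) where
  Hom := Hom
  id := Hom.id
  comp := Hom.comp
  id_comp := Hom.id_comp
  comp_id := Hom.comp_id
  assoc := Hom.comp_assoc

end ValuedSet

/-- A category is cartesian closed if it has finite products and each functor `Y × -` has a
right adjoint. -/
def IsCartesianClosed (C : Type u) [Category.{v} C] : Prop :=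
  ∃ _ : CartesianMonoidalCategory C, Nonempty (MonoidalClosed C)

/-!
Write `I_s` for the set of two global points that are equal to degree `s`. A map `Y × I_s → Z` is a
homotopy between two maps `Y → Z`. If the exponential `Z ^ Y` exists, such homotopies are the pairs
of points of `Z ^ Y` that are equal to degree at least `s`, so transitivity of equality concatenates
homotopies at `s` and at `t` to a homotopy at `s * t`. Equality in a product is computed by the
meet, not by `*`: for `Y = I_{p * p}` and `Z = [0,1]`, concatenating two homotopies at `p` forces
`p * p ≤ p * p * p`. Then every square is idempotent, and by continuity every element is a square,
so `*` is the minimum.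

For the minimum t-norm, an element of `Z ^ Y` is a morphism to `Z` from the restriction of `Y` to
some extent, and two such are equal to the largest degree to which they are defined and agree.
-/

namespace ContinuousTNorm

variable (T : ContinuousTNorm)

lemma one_imp (r : I) : T.imp 1 r = r :=
  le_antisymm (by simpa only [T.one_op] using T.op_imp_le 1 r)
    ((T.op_le_iff _ _ _).1 (T.one_op r).le)

lemma imp_anti {e q : I} (h : e ≤ q) (r : I) : T.imp q r ≤ T.imp e r :=
  (T.op_le_iff _ _ _).1 ((T.op_right _ h).trans (T.op_imp_le q r))

lemma imp_op_imp_le (p q r : I) : T.op (T.imp p q) (T.imp q r) ≤ T.imp p r := by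
  rw [← T.op_le_iff, ← T.assoc]
  exact (T.op_right _ (T.op_imp_le p q)).trans (T.op_imp_le q r)

lemma eq_minimum_of_op_self (h : ∀ p, T.op p p = p) : T = minimum := by
  ext p q : 3
  refine le_antisymm (le_inf (T.op_le_left p q) (T.op_le_right p q)) ?_
  exact (h (p ⊓ q)).ge.trans (T.mono _ _ _ _ inf_le_left inf_le_right)

lemma exists_op_self_eq (r : I) : ∃ p, T.op p p = r := by
  have hc : Continuous fun p => T.op p p := T.cont.comp (continuous_id.prodMk continuous_id)
  refine intermediate_value_univ 0 1 hc ?_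
  rw [T.op_zero, T.op_one]
  exact r.2

/-- Since every `r` is a square `p * p`, it is idempotent as soon as `p * p = p * p * p`. -/
lemma eq_minimum_of_square_le_cube (h : ∀ p, T.op p p ≤ T.op p (T.op p p)) : T = minimum := by
  refine T.eq_minimum_of_op_self fun r => ?_
  obtain ⟨p, rfl⟩ := T.exists_op_self_eq r
  have hp : T.op p (T.op p p) = T.op p p := le_antisymm (T.op_le_right _ _) (h p)
  rw [T.assoc, hp, hp]

/-- `e` is a retract of `q` in the quantaloid `D[0,1]_*`: the arrows `e → q` and `q → e` given by
`e` itself compose to the identity of `e`. Elements of extent `q` can then be restricted to `e`. -/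
structure IsRetract (e q : I) : Prop where
  le : e ≤ q
  op_imp : T.op e (T.imp q e) = e

variable {T} {e q : I}

lemma IsRetract.refl (q : I) : T.IsRetract q q := ⟨le_rfl, by rw [T.imp_self, T.op_one]⟩

lemma IsRetract.op_imp_of_le (h : T.IsRetract e q) {b : I} (hb : b ≤ e) :
    T.op b (T.imp q e) = b := by
  rw [← T.op_imp hb, T.comm e, T.assoc, h.op_imp]

lemma IsRetract.inf_le_op_imp (h : T.IsRetract e q) (b : I) : e ⊓ b ≤ T.op b (T.imp q e) :=
  (h.op_imp_of_le inf_le_left).ge.trans (T.op_right _ inf_le_right)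

lemma IsRetract.op_imp_le (h : T.IsRetract e q) {b : I} (hb : b ≤ e) (a : I) :
    T.op b (T.imp e a) ≤ T.op b (T.imp q a) := by
  conv_lhs => rw [← h.op_imp_of_le hb, T.assoc]
  exact T.op_left b (T.imp_op_imp_le q e a)

lemma minimum_op (p q : I) : minimum.op p q = p ⊓ q := rfl

lemma inf_minimum_imp {b : I} (h : b ≤ q) (a : I) : b ⊓ minimum.imp q a = b ⊓ a :=
  le_antisymm (le_inf inf_le_left ((inf_le_inf_right _ h).trans (minimum.op_imp_le q a)))
    (inf_le_inf_left _ ((minimum.op_le_iff _ _ _).1 (minimum.op_le_right q a)))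

lemma isRetract_minimum (h : e ≤ q) : minimum.IsRetract e q :=
  ⟨h, by rw [minimum_op, inf_minimum_imp h, inf_idem]⟩

end ContinuousTNorm

namespace ValuedSet

variable {T : ContinuousTNorm}

/-! ### Constructing morphisms -/

namespace Hom

variable {X Y Z : ValuedSet.{u} T}

lemma eq_of_rel_le {f g : Hom X Y} (h : ∀ x y, f.rel x y ≤ g.rel x y) : f = g := by
  ext x y : 3
  refine le_antisymm (h x y) ?_
  rw [← T.op_imp (g.le_left x y), T.comm]
  refine (T.op_left _ (f.total x x)).trans ?_
  rw [T.op_iSup]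
  refine iSup_le fun y' => ?_
  have hg : T.op (T.imp (X.eq x x) (g.rel x y)) (f.rel x y') ≤ Y.eq y y' := by
    rw [T.comm]
    exact (T.op_right _ (h x y')).trans (g.functional x y y')
  rw [← T.assoc]
  refine (T.op_right _ hg).trans ?_
  rw [T.swap (f.le_right x y') (Y.eq_le_right y y'), Y.symm y y']
  exact f.compat_right x y' y

/-- A constructor for morphisms in which compatibility is checked in each variable separately and
totality only on the diagonal. -/
def mk' (rel : X.carrier → Y.carrier → I)
    (le_left : ∀ x y, rel x y ≤ X.eq x x) (le_right : ∀ x y, rel x y ≤ Y.eq y y)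
    (compat_left : ∀ x x' y, T.op (rel x y) (T.imp (X.eq x x) (X.eq x' x)) ≤ rel x' y)
    (compat_right : ∀ x y y', T.op (rel x y) (T.imp (Y.eq y y) (Y.eq y y')) ≤ rel x y')
    (functional : ∀ x y y', T.op (rel x y') (T.imp (X.eq x x) (rel x y)) ≤ Y.eq y y')
    (total : ∀ x, X.eq x x ≤ ⨆ y, T.op (rel x y) (T.imp (Y.eq y y) (rel x y))) : Hom X Y where
  rel := rel
  le_extent x y := le_inf (le_left x y) (le_right x y)
  compat x x' y y' := by
    rw [T.comm (T.imp _ _)]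
    exact (T.op_right _ (compat_right x y y')).trans (compat_left x x' y')
  functional := functional
  total x x' := by
    rw [← T.op_imp (X.eq_le_left x x')]
    refine (T.op_right _ (total x)).trans ?_
    rw [T.iSup_op]
    refine iSup_mono fun y => ?_
    rw [T.assoc, T.comm (T.imp _ _), ← T.assoc, X.symm x x']
    exact T.op_right _ (compat_left x x' y)

/-- The morphism induced by a map `m` of the carriers that does not decrease equality. The element
`m x` is restricted to the extent of `x`, which is required to be a retract of its own extent. -/
def ofFun (m : X.carrier → Y.carrier) (hE : ∀ x, T.IsRetract (X.eq x x) (Y.eq (m x) (m x)))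
    (hm : ∀ x x', X.eq x x' ≤ Y.eq (m x) (m x')) : Hom X Y :=
  mk' (fun x y => X.eq x x ⊓ Y.eq (m x) y)
    (le_left := fun _ _ => inf_le_left)
    (le_right := fun _ _ => inf_le_right.trans (Y.eq_le_right _ _))
    (compat_left := fun x x' y => by
      refine le_inf ?_ (((hE x).op_imp_le inf_le_left _).trans ?_)
      · exact ((T.op_right _ inf_le_left).trans (T.op_imp_le _ _)).trans (X.eq_le_left x' x)
      · exact (T.mono _ _ _ _ inf_le_right (T.imp_mono _ (hm x' x))).trans
          ((id Y).compat_left (m x) (m x') y))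
    (compat_right := fun x y y' =>
      le_inf ((T.op_le_left _ _).trans inf_le_left)
        ((T.op_right _ inf_le_right).trans
          ((T.comm _ _).trans_le ((id Y).compat_right (m x) y y'))))
    (functional := fun x y y' => ((hE x).op_imp_le inf_le_left _).trans
      ((T.mono _ _ _ _ inf_le_right (T.imp_mono _ inf_le_right)).trans
        ((id Y).functional (m x) y y')))
    (total := fun x => by
      refine le_trans ?_ (le_iSup _ (m x))
      rw [inf_eq_left.2 (hE x).le, (hE x).op_imp])

lemma ofFun_comp_rel (m : X.carrier → Y.carrier) (hE hm) (g : Hom Y Z) (x : X.carrier)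
    (z : Z.carrier) : (comp (ofFun m hE hm) g).rel x z = X.eq x x ⊓ g.rel (m x) z := by
  refine le_antisymm (le_inf (compRel_le_left _ g x z) (iSup_le fun y => ?_)) ?_
  · exact (T.op_left _ (T.imp_mono _ inf_le_right)).trans (g.compat_left y (m x) z)
  · refine ((hE x).inf_le_op_imp _).trans (le_trans ?_ (le_iSup _ (m x)))
    exact T.op_left _ (T.imp_mono _ (le_inf le_rfl (hE x).le))

lemma eq_le_of_rel_eq (f : Hom X Y) {x x' : X.carrier} {y y' : Y.carrier}
    (h : f.rel x = Y.eq y) (h' : f.rel x' = Y.eq y') : X.eq x x' ≤ Y.eq y y' := by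
  refine (f.total x x').trans (iSup_le fun w => ?_)
  rw [h, h', Y.symm y' w]
  exact Y.trans y w y'

end Hom

/-! ### Binary products -/

/-- Any two elements of `X` and `Y` can be restricted to their common extent, so that the binary
product of `X` and `Y` is carried by the pairs of elements. -/
class Commensurable (X Y : ValuedSet.{u} T) : Prop where
  isRetract_left : ∀ x y, T.IsRetract (X.eq x x ⊓ Y.eq y y) (X.eq x x)
  isRetract_right : ∀ x y, T.IsRetract (X.eq x x ⊓ Y.eq y y) (Y.eq y y)

instance (X Y : ValuedSet.{u} ContinuousTNorm.minimum) : Commensurable X Y where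
  isRetract_left _ _ := ContinuousTNorm.isRetract_minimum inf_le_left
  isRetract_right _ _ := ContinuousTNorm.isRetract_minimum inf_le_right

section prod

open Commensurable

variable (X Y : ValuedSet.{u} T) [Commensurable X Y]

/-- The binary product. -/
def prod : ValuedSet.{u} T where
  carrier := X.carrier × Y.carrier
  eq a b := X.eq a.1 b.1 ⊓ Y.eq a.2 b.2
  le_extent a b := le_inf
    (inf_le_inf (X.eq_le_left _ _) (Y.eq_le_left _ _))
    (inf_le_inf (X.eq_le_right _ _) (Y.eq_le_right _ _))
  symm a b := by rw [X.symm, Y.symm]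
  trans a b c := by
    have hb : X.eq b.1 c.1 ⊓ Y.eq b.2 c.2 ≤ X.eq b.1 b.1 ⊓ Y.eq b.2 b.2 :=
      inf_le_inf (X.eq_le_left _ _) (Y.eq_le_left _ _)
    refine le_inf (((isRetract_left b.1 b.2).op_imp_le hb _).trans ?_)
      (((isRetract_right b.1 b.2).op_imp_le hb _).trans ?_)
    · exact (T.mono _ _ _ _ inf_le_left (T.imp_mono _ inf_le_left)).trans (X.trans _ _ _)
    · exact (T.mono _ _ _ _ inf_le_right (T.imp_mono _ inf_le_right)).trans (Y.trans _ _ _)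

/-- The first projection. -/
def prodFst : prod X Y ⟶ X :=
  Hom.ofFun Prod.fst (fun a => isRetract_left a.1 a.2) (fun _ _ => inf_le_left)

/-- The second projection. -/
def prodSnd : prod X Y ⟶ Y :=
  Hom.ofFun Prod.snd (fun a => isRetract_right a.1 a.2) (fun _ _ => inf_le_right)

variable {X Y} {Z : ValuedSet.{u} T}

lemma eq_self_le_iSup_inf (f : Z ⟶ X) (g : Z ⟶ Y) (z : Z.carrier) :
    Z.eq z z ≤ ⨆ a : (prod X Y).carrier, T.op (Hom.rel f z a.1 ⊓ Hom.rel g z a.2)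
      (T.imp ((prod X Y).eq a a) (Hom.rel f z a.1 ⊓ Hom.rel g z a.2)) := by
  refine le_of_forall_lt fun t ht => ?_
  obtain ⟨x, hx⟩ := lt_iSup_iff.1 (ht.trans_le (Hom.total f z z))
  obtain ⟨y, hy⟩ := lt_iSup_iff.1 (ht.trans_le (Hom.total g z z))
  refine lt_iSup_iff.2 ⟨(x, y), ?_⟩
  rcases le_total (Hom.rel f z x) (Hom.rel g z y) with h | h
  · simp only [inf_eq_left.2 h]
    exact hx.trans_le (T.op_left _ (T.imp_anti inf_le_left _))
  · simp only [inf_eq_right.2 h]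
    exact hy.trans_le (T.op_left _ (T.imp_anti inf_le_right _))

/-- The pairing of two morphisms. -/
def prodLift (f : Z ⟶ X) (g : Z ⟶ Y) : Z ⟶ prod X Y :=
  Hom.mk' (fun z a => Hom.rel f z a.1 ⊓ Hom.rel g z a.2)
    (le_left := fun z a => inf_le_left.trans (Hom.le_left f z a.1))
    (le_right := fun z a => inf_le_inf (Hom.le_right f z a.1) (Hom.le_right g z a.2))
    (compat_left := fun z z' a => le_inf
      ((T.op_right _ inf_le_left).trans (Hom.compat_left f z z' a.1))
      ((T.op_right _ inf_le_right).trans (Hom.compat_left g z z' a.2)))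
    (compat_right := fun z a b => by
      have ha : Hom.rel f z a.1 ⊓ Hom.rel g z a.2 ≤ X.eq a.1 a.1 ⊓ Y.eq a.2 a.2 :=
        inf_le_inf (Hom.le_right f z a.1) (Hom.le_right g z a.2)
      refine le_inf (((isRetract_left a.1 a.2).op_imp_le ha _).trans ?_)
        (((isRetract_right a.1 a.2).op_imp_le ha _).trans ?_)
      · rw [T.comm]
        exact (T.mono _ _ _ _ (T.imp_mono _ inf_le_left) inf_le_left).trans
          (Hom.compat_right f z a.1 b.1)
      · rw [T.comm]
        exact (T.mono _ _ _ _ (T.imp_mono _ inf_le_right) inf_le_right).trans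
          (Hom.compat_right g z a.2 b.2))
    (functional := fun z a b => le_inf
      ((T.mono _ _ _ _ inf_le_left (T.imp_mono _ inf_le_left)).trans
        (Hom.functional f z a.1 b.1))
      ((T.mono _ _ _ _ inf_le_right (T.imp_mono _ inf_le_right)).trans
        (Hom.functional g z a.2 b.2)))
    (total := eq_self_le_iSup_inf f g)

lemma rel_le_comp_prodFst_rel (h : Z ⟶ prod X Y) (z : Z.carrier) (a : (prod X Y).carrier) :
    Hom.rel h z a ≤ Hom.rel (h ≫ prodFst X Y) z a.1 := by
  refine (T.op_imp (Hom.le_right h z a)).ge.trans (le_trans ?_ (le_iSup _ a))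
  exact T.op_right _ (le_inf le_rfl inf_le_left)

lemma rel_le_comp_prodSnd_rel (h : Z ⟶ prod X Y) (z : Z.carrier) (a : (prod X Y).carrier) :
    Hom.rel h z a ≤ Hom.rel (h ≫ prodSnd X Y) z a.2 := by
  refine (T.op_imp (Hom.le_right h z a)).ge.trans (le_trans ?_ (le_iSup _ a))
  exact T.op_right _ (le_inf le_rfl inf_le_right)

lemma prodLift_fst (f : Z ⟶ X) (g : Z ⟶ Y) : prodLift f g ≫ prodFst X Y = f := by
  refine Hom.eq_of_rel_le fun z x => iSup_le fun a => ?_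
  refine ((isRetract_left a.1 a.2).op_imp_le inf_le_left _).trans ?_
  refine (T.mono _ _ _ _ inf_le_right (T.imp_mono _ inf_le_left)).trans ?_
  rw [T.swap (Hom.le_right f z a.1) (X.eq_le_left a.1 x)]
  exact Hom.compat_right f z a.1 x

lemma prodLift_snd (f : Z ⟶ X) (g : Z ⟶ Y) : prodLift f g ≫ prodSnd X Y = g := by
  refine Hom.eq_of_rel_le fun z y => iSup_le fun a => ?_
  refine ((isRetract_right a.1 a.2).op_imp_le inf_le_left _).trans ?_
  refine (T.mono _ _ _ _ inf_le_right (T.imp_mono _ inf_le_right)).trans ?_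
  rw [T.swap (Hom.le_right g z a.2) (Y.eq_le_left a.2 y)]
  exact Hom.compat_right g z a.2 y

lemma eq_prodLift (h : Z ⟶ prod X Y) : h = prodLift (h ≫ prodFst X Y) (h ≫ prodSnd X Y) :=
  Hom.eq_of_rel_le fun z a =>
    le_inf (rel_le_comp_prodFst_rel h z a) (rel_le_comp_prodSnd_rel h z a)

variable (X Y) in
/-- The universal property of the product. -/
noncomputable def prodIsLimit : Limits.IsLimit (Limits.BinaryFan.mk (prodFst X Y) (prodSnd X Y)) :=
  Limits.BinaryFan.IsLimit.mk _ prodLift prodLift_fst prodLift_snd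
    (fun f g h hf hg => by
      subst hf hg
      exact eq_prodLift h)

end prod

/-! ### Global valued sets -/

/-- A valued set is global if all its elements have extent `1`; it is then a set with a
`T`-similarity. -/
class IsGlobal (X : ValuedSet.{u} T) : Prop where
  extent_eq_one : ∀ x, X.eq x x = 1

section IsGlobal

open IsGlobal

variable {X Y Z : ValuedSet.{u} T}

/-- A `T`-similarity, as a global valued set. -/
def ofSimilarity (S : Type u) (d : S → S → I) (refl : ∀ x, d x x = 1)
    (symm : ∀ x y, d x y = d y x) (trans : ∀ x y z, T.op (d x y) (d y z) ≤ d x z) :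
    ValuedSet.{u} T where
  carrier := S
  eq := d
  le_extent x y := by
    rw [refl, refl, inf_idem]
    exact unitInterval.le_one'
  symm := symm
  trans x y z := by
    rw [refl, T.one_imp, T.comm]
    exact trans x y z

instance (S : Type u) (d : S → S → I) (refl symm trans) :
    IsGlobal (ofSimilarity (T := T) S d refl symm trans) := ⟨refl⟩

instance [IsGlobal X] [IsGlobal Y] : Commensurable X Y where
  isRetract_left x y := by
    rw [extent_eq_one, extent_eq_one, inf_idem]
    exact .refl 1
  isRetract_right x y := by
    rw [extent_eq_one, extent_eq_one, inf_idem]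
    exact .refl 1

instance [IsGlobal X] [IsGlobal Y] : IsGlobal (prod X Y) where
  extent_eq_one a := (congrArg₂ _ (extent_eq_one a.1) (extent_eq_one a.2)).trans (inf_idem 1)

/-- The morphism of global valued sets induced by a map that does not decrease equality. -/
def ofMap [IsGlobal X] [IsGlobal Y] (m : X.carrier → Y.carrier)
    (hm : ∀ x x', X.eq x x' ≤ Y.eq (m x) (m x')) : X ⟶ Y :=
  Hom.ofFun m (fun x => by rw [extent_eq_one, extent_eq_one]; exact .refl 1) hm

lemma ofMap_comp_rel [IsGlobal X] [IsGlobal Y] (m : X.carrier → Y.carrier) (hm) (g : Y ⟶ Z)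
    (x : X.carrier) : Hom.rel (ofMap m hm ≫ g) x = Hom.rel g (m x) := by
  funext z
  refine (Hom.ofFun_comp_rel m _ hm g x z).trans ?_
  rw [extent_eq_one, inf_eq_right]
  exact unitInterval.le_one'

lemma ofMap_rel [IsGlobal X] [IsGlobal Y] (m : X.carrier → Y.carrier) (hm) (x : X.carrier) :
    Hom.rel (ofMap m hm) x = Y.eq (m x) := by
  rw [← Category.comp_id (ofMap m hm), ofMap_comp_rel]
  rfl

lemma ofMap_comp_ofMap [IsGlobal X] [IsGlobal Y] [IsGlobal Z] (m : X.carrier → Y.carrier) (hm)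
    (n : Y.carrier → Z.carrier) (hn) :
    ofMap m hm ≫ ofMap n hn = ofMap (n ∘ m) (fun x x' => (hm x x').trans (hn _ _)) :=
  Hom.ext (funext fun x => by rw [ofMap_comp_rel, ofMap_rel, ofMap_rel]; rfl)

variable (X) in
/-- The constant morphism of global valued sets. -/
def const [IsGlobal X] [IsGlobal Y] (y : Y.carrier) : X ⟶ Y :=
  ofMap (fun _ => y) (fun _ _ => unitInterval.le_one'.trans (extent_eq_one y).ge)

lemma const_comp_const [IsGlobal X] [IsGlobal Y] [IsGlobal Z] (y : Y.carrier) (z : Z.carrier) :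
    const X y ≫ const Y z = const X z := ofMap_comp_ofMap _ _ _ _

variable (X) in
/-- The inclusion of `X` into its product with `Y` at the element `y`. -/
def prodMk [IsGlobal X] [IsGlobal Y] (y : Y.carrier) : X ⟶ prod X Y :=
  ofMap (fun x => (x, y))
    (fun _ _ => le_inf le_rfl (unitInterval.le_one'.trans (extent_eq_one y).ge))

lemma prodMk_comp_rel [IsGlobal X] [IsGlobal Y] (y : Y.carrier) (h : prod X Y ⟶ Z)
    (x : X.carrier) : Hom.rel (prodMk X y ≫ h) x = Hom.rel h (x, y) := ofMap_comp_rel _ _ _ _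

lemma prodMk_comp_prodFst [IsGlobal X] [IsGlobal Y] (y : Y.carrier) :
    prodMk X y ≫ prodFst X Y = 𝟙 X :=
  (ofMap_comp_ofMap _ _ _ _).trans (Hom.ext (funext fun x => ofMap_rel _ _ x))

lemma prodMk_comp_prodSnd [IsGlobal X] [IsGlobal Y] (y : Y.carrier) :
    prodMk X y ≫ prodSnd X Y = const X y :=
  ofMap_comp_ofMap _ _ _ _

end IsGlobal

section points

open IsGlobal

/-- The singleton of extent `1`. -/
def point (T : ContinuousTNorm) : ValuedSet.{u} T :=
  ofSimilarity PUnit (fun _ _ => 1) (fun _ => rfl) (fun _ _ => rfl) (fun _ _ _ => (T.one_op 1).le)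

instance : IsGlobal (point.{u} T) := inferInstanceAs (IsGlobal (ofSimilarity _ _ _ _ _))

/-- The element of `point T`. -/
def star : (point.{u} T).carrier := PUnit.unit

variable {X E : ValuedSet.{u} T}

lemma hom_point_ext (f g : X ⟶ point T) : f = g :=
  Hom.eq_of_rel_le fun x _ => (Hom.le_left f x _).trans
    ((Hom.total g x x).trans (iSup_le fun _ => T.op_le_left _ _))

/-- The degree to which two global elements of `E` are equal. -/
noncomputable def pointEq (e e' : point.{u} T ⟶ E) : I :=
  ⨆ w, T.op (Hom.rel e' star w) (T.imp (E.eq w w) (Hom.rel e star w))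

lemma pointEq_comm (e e' : point.{u} T ⟶ E) : pointEq e e' = pointEq e' e :=
  iSup_congr fun w => by
    rw [T.swap (Hom.le_right e _ w) (Hom.le_right e' _ w), T.comm]

lemma pointEq_self (e : point.{u} T ⟶ E) : pointEq e e = 1 :=
  le_antisymm unitInterval.le_one' (Hom.total e star star)

lemma pointEq_op_rel_le (e e' : point.{u} T ⟶ E) (w : E.carrier) :
    T.op (pointEq e e') (Hom.rel e star w) ≤ Hom.rel e' star w := by
  rw [pointEq, T.iSup_op]
  refine iSup_le fun v => ?_
  have h : T.op (Hom.rel e star v) (Hom.rel e star w) ≤ E.eq w v := by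
    simpa only [extent_eq_one, T.one_imp] using Hom.functional e star w v
  rw [T.swap (Hom.le_right e _ v) (Hom.le_right e' _ v), T.assoc]
  refine (T.op_left _ h).trans ?_
  rw [E.symm w v, ← T.swap (E.eq_le_left v w) (Hom.le_right e' _ v), T.comm]
  exact Hom.compat_right e' _ v w

lemma pointEq_trans (e e' e'' : point.{u} T ⟶ E) :
    T.op (pointEq e e') (pointEq e' e'') ≤ pointEq e e'' := by
  rw [pointEq_comm e e', pointEq, pointEq, T.op_iSup]
  refine iSup_mono fun w => ?_
  rw [T.op_left_comm]
  refine T.op_left _ ?_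
  rw [T.comm]
  refine (T.imp_op_le _ _ _).trans (T.imp_mono _ ?_)
  rw [T.comm]
  exact pointEq_op_rel_le e' e w

variable [IsGlobal X]

lemma eq_le_pointEq_const_comp (f : X ⟶ E) (x x' : X.carrier) :
    X.eq x x' ≤ pointEq (const (point T) x ≫ f) (const (point T) x' ≫ f) := by
  simp only [pointEq, const, ofMap_comp_rel]
  exact Hom.total f x _

/-- The morphism out of a global valued set given by a family of global elements. -/
def ofPoints (e : X.carrier → (point.{u} T ⟶ E))
    (he : ∀ x x', X.eq x x' ≤ pointEq (e x) (e x')) : X ⟶ E where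
  rel x := Hom.rel (e x) star
  le_extent x w := by
    rw [extent_eq_one x]
    exact Hom.le_extent (e x) star w
  compat x x' w w' := by
    rw [extent_eq_one x, T.one_imp, T.comm]
    refine (T.op_left _ (Hom.compat_right (e x) _ w w')).trans ?_
    rw [X.symm]
    exact (T.op_right _ (he x x')).trans (pointEq_op_rel_le _ _ _)
  functional x w w' := by
    rw [extent_eq_one x]
    exact Hom.functional (e x) star w w'
  total := he

lemma const_comp_ofPoints (e : X.carrier → (point.{u} T ⟶ E)) (he) (x : X.carrier) :
    const (point T) x ≫ ofPoints e he = e x :=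
  Hom.ext (funext fun _ => ofMap_comp_rel _ _ _ _)

end points

section twoPoint

open IsGlobal

variable {s t : I} {W : ValuedSet.{u} T}

/-- Two global elements that are equal to degree `s`. -/
def twoPoint (T : ContinuousTNorm) (s : I) : ValuedSet.{u} T :=
  ofSimilarity (ULift Bool) (fun a b => if a = b then 1 else s) (fun _ => if_pos rfl)
    (fun a b => by simp only [eq_comm])
    (fun a b c => by
      by_cases hab : a = b
      · rw [if_pos hab, T.one_op, hab]
      · rw [if_neg hab]
        refine (T.op_le_left _ _).trans ?_
        split_ifs
        exacts [unitInterval.le_one', le_rfl])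

instance (s : I) : IsGlobal (twoPoint.{u} T s) :=
  inferInstanceAs (IsGlobal (ofSimilarity _ _ _ _ _))

/-- The elements of `twoPoint T s`. -/
def twoPointElt (s : I) (b : Bool) : (twoPoint.{u} T s).carrier := ⟨b⟩

lemma twoPoint_eq_of_ne {b b' : Bool} (h : b ≠ b') :
    (twoPoint.{u} T s).eq (twoPointElt s b) (twoPointElt s b') = s :=
  if_neg fun hb => h (congrArg ULift.down hb)

lemma twoPoint_forall {p : (twoPoint.{u} T s).carrier → Prop} :
    (∀ a, p a) ↔ p (twoPointElt s false) ∧ p (twoPointElt s true) :=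
  ULift.forall.trans Bool.forall_bool

lemma le_pointEq_iff {e e' : point.{u} T ⟶ W} :
    s ≤ pointEq e e' ↔ ∃ f : twoPoint T s ⟶ W,
      const (point T) (twoPointElt s false) ≫ f = e ∧
        const (point T) (twoPointElt s true) ≫ f = e' := by
  constructor
  · intro h
    refine ⟨ofPoints (fun a => bif a.down then e' else e) ?_,
      const_comp_ofPoints _ _ _, const_comp_ofPoints _ _ _⟩
    simp only [twoPoint_forall, extent_eq_one, twoPoint_eq_of_ne Bool.false_ne_true,
      twoPoint_eq_of_ne Bool.false_ne_true.symm]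
    exact ⟨⟨(pointEq_self e).ge, h⟩, ⟨h.trans (pointEq_comm e e').le, (pointEq_self e').ge⟩⟩
  · rintro ⟨f, rfl, rfl⟩
    exact (twoPoint_eq_of_ne Bool.false_ne_true).ge.trans (eq_le_pointEq_const_comp f _ _)

/-- The morphism from `twoPoint T s` to a global valued set given by two elements. -/
def twoPointMap [IsGlobal W] (w w' : W.carrier) (h : s ≤ W.eq w w') : twoPoint T s ⟶ W :=
  ofMap (fun a => bif a.down then w' else w) (by
    simp only [twoPoint_forall, extent_eq_one, twoPoint_eq_of_ne Bool.false_ne_true,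
      twoPoint_eq_of_ne Bool.false_ne_true.symm]
    exact ⟨⟨le_rfl, h⟩, ⟨h.trans (W.symm w w').le, le_rfl⟩⟩)

end twoPoint

/-! ### Gluing homotopies -/

section prodIsoTensor

open MonoidalCategory CartesianMonoidalCategory

variable [CartesianMonoidalCategory (ValuedSet.{u} T)] (X Y : ValuedSet.{u} T) [Commensurable X Y]

/-- The comparison of the two binary products. -/
noncomputable def prodIsoTensor : prod X Y ≅ X ⊗ Y :=
  (prodIsLimit X Y).conePointUniqueUpToIso (tensorProductIsBinaryProduct X Y)

lemma prodIsoTensor_hom_fst : (prodIsoTensor X Y).hom ≫ fst X Y = prodFst X Y :=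
  Limits.IsLimit.conePointUniqueUpToIso_hom_comp _ (tensorProductIsBinaryProduct X Y) ⟨.left⟩

lemma prodIsoTensor_hom_snd : (prodIsoTensor X Y).hom ≫ snd X Y = prodSnd X Y :=
  Limits.IsLimit.conePointUniqueUpToIso_hom_comp _ (tensorProductIsBinaryProduct X Y) ⟨.right⟩

end prodIsoTensor

section homotopy

open IsGlobal MonoidalCategory CartesianMonoidalCategory MonoidalClosed

variable [CartesianMonoidalCategory (ValuedSet.{u} T)] {X Y W : ValuedSet.{u} T} [IsGlobal Y]
  {s t : I}

/-- The morphisms `a` and `a'` are the ends of a homotopy `Y ⊗ twoPoint T s ⟶ W`, in which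
`twoPoint T s` takes the place of the interval. -/
def HomotopicAt (s : I) (a a' : Y ⟶ W) : Prop :=
  ∃ h : Y ⊗ twoPoint T s ⟶ W,
    lift (𝟙 Y) (const Y (twoPointElt s false)) ≫ h = a ∧
      lift (𝟙 Y) (const Y (twoPointElt s true)) ≫ h = a'

section Closed

variable [Closed Y]

/-- The global element of the exponential that corresponds to a morphism. -/
noncomputable def name (a : Y ⟶ W) : point T ⟶ (ihom Y).obj W := curry (fst Y (point T) ≫ a)

lemma name_injective : Function.Injective (name : (Y ⟶ W) → _) := fun a a' h => by
  have h := congrArg (lift (𝟙 Y) (const Y star) ≫ ·) (curry_injective h)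
  simpa only [lift_fst_assoc, Category.id_comp] using h

lemma const_comp_curry [IsGlobal X] (x : X.carrier) (h : Y ⊗ X ⟶ W) :
    const (point T) x ≫ curry h = name (lift (𝟙 Y) (const Y x) ≫ h) := by
  have hx : Y ◁ const (point T) x = fst Y (point T) ≫ lift (𝟙 Y) (const Y x) := by
    refine CartesianMonoidalCategory.hom_ext _ _ ?_ ?_
    · simp only [whiskerLeft_fst, Category.assoc, lift_fst, Category.comp_id]
    · rw [whiskerLeft_snd, hom_point_ext (snd Y (point T)) (fst Y (point T) ≫ const Y star),
        Category.assoc, Category.assoc, const_comp_const, lift_snd]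
  rw [← curry_natural_left, hx, Category.assoc, name]

lemma homotopicAt_iff_le_pointEq {a a' : Y ⟶ W} :
    HomotopicAt s a a' ↔ s ≤ pointEq (name a) (name a') := by
  have curry_surjective : Function.Surjective (curry : (Y ⊗ twoPoint T s ⟶ W) → _) :=
    fun k => ⟨uncurry k, curry_uncurry k⟩
  rw [le_pointEq_iff, curry_surjective.exists]
  simp only [HomotopicAt, const_comp_curry, name_injective.eq_iff]

/-- In the exponential, homotopies can be concatenated because equality is transitive. -/
lemma HomotopicAt.trans {a b c : Y ⟶ W} (hab : HomotopicAt s a b) (hbc : HomotopicAt t b c) :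
    HomotopicAt (T.op s t) a c := by
  rw [homotopicAt_iff_le_pointEq] at hab hbc ⊢
  exact (T.mono _ _ _ _ hab hbc).trans (pointEq_trans _ _ _)

end Closed

variable [IsGlobal X] [IsGlobal W]

lemma prodMk_comp_prodIsoTensor_hom (x : X.carrier) :
    prodMk Y x ≫ (prodIsoTensor Y X).hom = lift (𝟙 Y) (const Y x) := by
  refine CartesianMonoidalCategory.hom_ext _ _ ?_ ?_
  · rw [Category.assoc, prodIsoTensor_hom_fst, lift_fst, prodMk_comp_prodFst]
  · rw [Category.assoc, prodIsoTensor_hom_snd, lift_snd, prodMk_comp_prodSnd]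

lemma homotopicAt_ofMap_iff {m m' : Y.carrier → W.carrier} {hm hm'} :
    HomotopicAt s (ofMap (X := Y) (Y := W) m hm) (ofMap m' hm') ↔
      ∀ y y', Y.eq y y' ⊓ s ≤ W.eq (m y) (m' y') := by
  simp only [HomotopicAt, ← prodMk_comp_prodIsoTensor_hom, Category.assoc]
  constructor
  · rintro ⟨h, h₀, h₁⟩ y y'
    have hy := (prodMk_comp_rel (twoPointElt s false) _ y).symm.trans
      ((congrArg (Hom.rel · y) h₀).trans (ofMap_rel m hm y))
    have hy' := (prodMk_comp_rel (twoPointElt s true) _ y').symm.trans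
      ((congrArg (Hom.rel · y') h₁).trans (ofMap_rel m' hm' y'))
    exact (inf_le_inf_left _ (twoPoint_eq_of_ne Bool.false_ne_true).ge).trans
      (Hom.eq_le_of_rel_eq _ hy hy')
  · intro h
    have hs (y y') : (prod Y (twoPoint T s)).eq (y, twoPointElt s false) (y', twoPointElt s true) ≤
        W.eq (m y) (m' y') :=
      (inf_le_inf_left _ (twoPoint_eq_of_ne Bool.false_ne_true).le).trans (h y y')
    have hf : ∀ a a' : (prod Y (twoPoint T s)).carrier, (prod Y (twoPoint T s)).eq a a' ≤
        W.eq (bif a.2.down then m' a.1 else m a.1) (bif a'.2.down then m' a'.1 else m a'.1) := by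
      rintro ⟨y, ⟨_ | _⟩⟩ ⟨y', ⟨_ | _⟩⟩
      · exact inf_le_left.trans (hm y y')
      · exact hs y y'
      · exact ((prod Y (twoPoint T s)).symm _ _).trans_le ((hs y' y).trans (W.symm _ _).le)
      · exact inf_le_left.trans (hm' y y')
    refine ⟨(prodIsoTensor Y (twoPoint T s)).inv ≫ ofMap _ hf, ?_, ?_⟩ <;>
      rw [Iso.hom_inv_id_assoc] <;> exact ofMap_comp_ofMap _ _ _ _

lemma homotopicAt_twoPointMap_iff {w w' v v' : W.carrier} {hw : s ≤ W.eq w w'}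
    {hv : s ≤ W.eq v v'} :
    HomotopicAt t (twoPointMap w w' hw) (twoPointMap v v' hv) ↔
      (t ≤ W.eq w v ∧ s ⊓ t ≤ W.eq w v') ∧ s ⊓ t ≤ W.eq w' v ∧ t ≤ W.eq w' v' := by
  rw [twoPointMap, twoPointMap, homotopicAt_ofMap_iff]
  simp only [twoPoint_forall, extent_eq_one, twoPoint_eq_of_ne Bool.false_ne_true,
    twoPoint_eq_of_ne Bool.false_ne_true.symm, inf_eq_right.2 (unitInterval.le_one' (t := t))]
  rfl

end homotopy

/-! ### The truth values -/

section truthValues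

/-- The unit interval with the biresiduum as equality. -/
noncomputable def truthValues (T : ContinuousTNorm) : ValuedSet.{u} T :=
  ofSimilarity (ULift I) (fun a b => T.imp a.down b.down ⊓ T.imp b.down a.down)
    (fun a => by rw [T.imp_self, inf_idem]) (fun a b => inf_comm _ _)
    (fun a b c => le_inf
      ((T.mono _ _ _ _ inf_le_left inf_le_left).trans (T.imp_op_imp_le _ _ _))
      ((T.mono _ _ _ _ inf_le_right inf_le_right).trans
        ((T.comm _ _).trans_le (T.imp_op_imp_le _ _ _))))

instance : IsGlobal (truthValues.{u} T) := inferInstanceAs (IsGlobal (ofSimilarity _ _ _ _ _))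

/-- The elements of `truthValues T`. -/
def truthValue (r : I) : (truthValues.{u} T).carrier := ⟨r⟩

lemma le_eq_truthValue_iff {a b t : I} :
    t ≤ (truthValues.{u} T).eq (truthValue a) (truthValue b) ↔ T.op a t ≤ b ∧ T.op b t ≤ a := by
  rw [T.op_le_iff, T.op_le_iff]
  exact le_inf_iff

lemma le_eq_truthValue_iff_of_le {a b t : I} (h : b ≤ a) :
    t ≤ (truthValues.{u} T).eq (truthValue a) (truthValue b) ↔ T.op a t ≤ b :=
  le_eq_truthValue_iff.trans (and_iff_left ((T.op_le_left b t).trans h))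

variable [CartesianMonoidalCategory (ValuedSet.{u} T)]

/-- With `c = p * p`, the maps from `twoPoint T c` to the truth values given by `(1, c)`, `(p, c)`
and `(c, p * c)` are consecutively homotopic at `p`. The concatenated homotopy at `p * p` compares
`1`, at one end, with `p * c`, at the other. -/
lemma square_le_cube (p : I) [Closed (twoPoint.{u} T (T.op p p))] :
    T.op p p ≤ T.op p (T.op p p) := by
  set c := T.op p p with hc
  have hcp : c ≤ p := T.op_le_left p p
  have hpc : T.op p c ≤ c := T.op_le_right p c
  have hm₀ : c ≤ (truthValues.{u} T).eq (truthValue 1) (truthValue c) :=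
    (le_eq_truthValue_iff_of_le unitInterval.le_one').2 (T.one_op c).le
  have hm₁ : c ≤ (truthValues.{u} T).eq (truthValue p) (truthValue c) :=
    (le_eq_truthValue_iff_of_le hcp).2 hpc
  have hm₂ : c ≤ (truthValues.{u} T).eq (truthValue c) (truthValue (T.op p c)) :=
    (le_eq_truthValue_iff_of_le hpc).2 (T.op_right c hcp)
  have h₀₁ : HomotopicAt p (twoPointMap _ _ hm₀) (twoPointMap _ _ hm₁) := by
    rw [homotopicAt_twoPointMap_iff, inf_eq_left.2 hcp]
    refine ⟨⟨?_, hm₀⟩, hm₁.trans ((truthValues T).symm _ _).le, ?_⟩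
    · exact (le_eq_truthValue_iff_of_le unitInterval.le_one').2 (T.one_op p).le
    · exact (le_eq_truthValue_iff_of_le le_rfl).2 (T.op_le_left c p)
  have h₁₂ : HomotopicAt p (twoPointMap _ _ hm₁) (twoPointMap _ _ hm₂) := by
    rw [homotopicAt_twoPointMap_iff, inf_eq_left.2 hcp]
    refine ⟨⟨?_, ?_⟩, ?_, ?_⟩
    · exact (le_eq_truthValue_iff_of_le hcp).2 hc.ge
    · exact (le_eq_truthValue_iff_of_le (T.op_le_left p c)).2 le_rfl
    · exact (le_eq_truthValue_iff_of_le le_rfl).2 (T.op_le_left c c)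
    · exact (le_eq_truthValue_iff_of_le hpc).2 (T.comm c p).le
  have h : c ⊓ c ≤ (truthValues.{u} T).eq (truthValue 1) (truthValue (T.op p c)) :=
    (homotopicAt_twoPointMap_iff.1 (h₀₁.trans h₁₂)).1.2
  rwa [inf_idem, le_eq_truthValue_iff_of_le unitInterval.le_one', T.one_op] at h

end truthValues

/-! ### The minimum t-norm -/

section minimum

open ContinuousTNorm

lemma inf_eq_le (X : ValuedSet.{u} minimum) (x y z : X.carrier) :
    X.eq x y ⊓ X.eq y z ≤ X.eq x z := by
  have h := X.trans x y z
  rwa [minimum_op, inf_minimum_imp (X.eq_le_left y z), inf_comm] at h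

/-- A constructor for valued sets over the minimum t-norm. -/
def mkOfMinimum (S : Type u) (eq : S → S → I) (symm : ∀ x y, eq x y = eq y x)
    (trans : ∀ x y z, eq x y ⊓ eq y z ≤ eq x z) : ValuedSet.{u} minimum :=
  have eq_le_left (x y) : eq x y ≤ eq x x := (le_inf le_rfl (symm x y).le).trans (trans x y x)
  { carrier := S
    eq := eq
    le_extent := fun x y => le_inf (eq_le_left x y) ((symm x y).trans_le (eq_le_left y x))
    symm := symm
    trans := fun x y z => by
      rw [minimum_op, inf_minimum_imp (eq_le_left y z), inf_comm]
      exact trans x y z }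

namespace Hom

variable {X Y Z : ValuedSet.{u} minimum}

lemma rel_inf_eq_left_le (f : Hom X Y) (x x' : X.carrier) (y : Y.carrier) :
    f.rel x y ⊓ X.eq x x' ≤ f.rel x' y := by
  have h := f.compat_left x x' y
  rwa [minimum_op, inf_minimum_imp (f.le_left x y), X.symm x' x] at h

lemma rel_inf_eq_right_le (f : Hom X Y) (x : X.carrier) (y y' : Y.carrier) :
    f.rel x y ⊓ Y.eq y y' ≤ f.rel x y' := by
  have h := f.compat_right x y y'
  rwa [minimum_op, inf_comm, inf_minimum_imp (f.le_right x y)] at h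

lemma rel_inf_rel_le (f : Hom X Y) (x : X.carrier) (y y' : Y.carrier) :
    f.rel x y ⊓ f.rel x y' ≤ Y.eq y y' := by
  have h := f.functional x y y'
  rwa [minimum_op, inf_minimum_imp (f.le_left x y'), inf_comm] at h

lemma eq_self_le_iSup (f : Hom X Y) (x : X.carrier) : X.eq x x ≤ ⨆ y, f.rel x y :=
  (f.total x x).trans (iSup_mono fun _ => inf_le_left)

/-- A constructor for morphisms over the minimum t-norm. -/
def mkOfMinimum (rel : X.carrier → Y.carrier → I)
    (le_left : ∀ x y, rel x y ≤ X.eq x x) (le_right : ∀ x y, rel x y ≤ Y.eq y y)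
    (compat_left : ∀ x x' y, rel x y ⊓ X.eq x x' ≤ rel x' y)
    (compat_right : ∀ x y y', rel x y ⊓ Y.eq y y' ≤ rel x y')
    (functional : ∀ x y y', rel x y ⊓ rel x y' ≤ Y.eq y y')
    (total : ∀ x, X.eq x x ≤ ⨆ y, rel x y) : Hom X Y :=
  mk' rel le_left le_right
    (fun x x' y => by
      rw [minimum_op, inf_minimum_imp (le_left x y), X.symm]
      exact compat_left x x' y)
    (fun x y y' => by
      rw [minimum_op, inf_minimum_imp (le_right x y)]
      exact compat_right x y y')
    (fun x y y' => by
      rw [minimum_op, inf_minimum_imp (le_left x y'), inf_comm]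
      exact functional x y y')
    (fun x => (total x).trans (iSup_mono fun y => by
      rw [minimum_op, inf_minimum_imp (le_right x y), inf_idem]))

lemma comp_rel (f : X ⟶ Y) (g : Y ⟶ Z) (x : X.carrier) (z : Z.carrier) :
    rel (f ≫ g) x z = ⨆ y, rel f x y ⊓ rel g y z :=
  iSup_congr fun y => by rw [minimum_op, inf_minimum_imp (g.le_left y z), inf_comm]

end Hom

/-- The singleton of extent `1` is terminal. -/
noncomputable def pointIsTerminal : Limits.IsTerminal (point.{u} minimum) :=
  Limits.IsTerminal.ofUniqueHom
    (fun _ => Hom.ofFun (fun _ => star) (fun _ => isRetract_minimum unitInterval.le_one')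
      (fun _ _ => unitInterval.le_one'))
    (fun _ _ => hom_point_ext _ _)

noncomputable instance : CartesianMonoidalCategory (ValuedSet.{u} minimum) :=
  .ofChosenFiniteProducts ⟨_, pointIsTerminal⟩ (fun X Y => ⟨_, prodIsLimit X Y⟩)

/-- The elements of `Y`, restricted to the extent `r`. -/
def restrict (Y : ValuedSet.{u} minimum) (r : I) : ValuedSet.{u} minimum :=
  mkOfMinimum Y.carrier (fun y y' => Y.eq y y' ⊓ r) (fun y y' => by rw [Y.symm])
    (fun _ _ _ => by
      rw [← inf_inf_distrib_right]
      exact inf_le_inf_right r (Y.inf_eq_le _ _ _))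

/-- A partial morphism from `Y` to `Z`, defined on the restriction of `Y` to some extent. -/
structure PartialHom (Y Z : ValuedSet.{u} minimum) where
  extent : I
  toHom : Hom (restrict Y extent) Z

namespace PartialHom

variable {Y Z : ValuedSet.{u} minimum}

/-- The underlying relation of a partial morphism. -/
def rel (F : PartialHom Y Z) (y : Y.carrier) (z : Z.carrier) : I := F.toHom.rel y z

lemma rel_le_eq_left (F : PartialHom Y Z) (y : Y.carrier) (z : Z.carrier) :
    F.rel y z ≤ Y.eq y y := (F.toHom.le_left y z).trans inf_le_left

lemma rel_le_extent (F : PartialHom Y Z) (y : Y.carrier) (z : Z.carrier) :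
    F.rel y z ≤ F.extent := (F.toHom.le_left y z).trans inf_le_right

lemma rel_inf_eq_left_le (F : PartialHom Y Z) (y y' : Y.carrier) (z : Z.carrier) :
    F.rel y z ⊓ Y.eq y y' ≤ F.rel y' z :=
  (le_inf inf_le_left (le_inf inf_le_right (inf_le_left.trans (F.rel_le_extent y z)))).trans
    (F.toHom.rel_inf_eq_left_le y y' z)

/-- `F` and `G` are defined on `r` and agree there. -/
def AgreeOn (F G : PartialHom Y Z) (r : I) : Prop :=
  r ≤ F.extent ∧ r ≤ G.extent ∧ ∀ y z, F.rel y z ⊓ r = G.rel y z ⊓ r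

/-- The largest extent on which `F` and `G` agree. -/
noncomputable def eq (F G : PartialHom Y Z) : I := sSup {r | AgreeOn F G r}

lemma agreeOn_eq (F G : PartialHom Y Z) : AgreeOn F G (eq F G) := by
  refine ⟨sSup_le fun r h => h.1, sSup_le fun r h => h.2.1, fun y z => ?_⟩
  simp only [eq, inf_sSup_eq]
  exact iSup_congr fun r => iSup_congr fun h => h.2.2 y z

lemma le_eq {F G : PartialHom Y Z} {r : I} (h : AgreeOn F G r) : r ≤ eq F G := le_sSup h

lemma rel_inf_eq_le_rel (F G : PartialHom Y Z) (y : Y.carrier) (z : Z.carrier) :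
    F.rel y z ⊓ eq F G ≤ G.rel y z :=
  ((agreeOn_eq F G).2.2 y z).trans_le inf_le_left

lemma eq_self (F : PartialHom Y Z) : eq F F = F.extent :=
  le_antisymm (agreeOn_eq F F).1 (le_eq ⟨le_rfl, le_rfl, fun _ _ => rfl⟩)

lemma AgreeOn.symm {F G : PartialHom Y Z} {r : I} (h : AgreeOn F G r) : AgreeOn G F r :=
  ⟨h.2.1, h.1, fun y z => (h.2.2 y z).symm⟩

lemma eq_comm (F G : PartialHom Y Z) : eq F G = eq G F :=
  le_antisymm (le_eq (agreeOn_eq F G).symm) (le_eq (agreeOn_eq G F).symm)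

lemma eq_trans (F G H : PartialHom Y Z) : eq F G ⊓ eq G H ≤ eq F H := by
  have h₁ := agreeOn_eq F G
  have h₂ := agreeOn_eq G H
  refine le_eq ⟨inf_le_left.trans h₁.1, inf_le_right.trans h₂.2.1, fun y z => ?_⟩
  rw [← inf_assoc, h₁.2.2, inf_right_comm, h₂.2.2, inf_assoc, inf_comm (eq G H)]

end PartialHom

/-- The exponential of `Z` by `Y`, whose elements are the partial morphisms. -/
noncomputable def exp (Y Z : ValuedSet.{u} minimum) : ValuedSet.{u} minimum :=
  mkOfMinimum (PartialHom Y Z) PartialHom.eq PartialHom.eq_comm PartialHom.eq_trans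

section exp

open MonoidalCategory CartesianMonoidalCategory

variable {X Y Z : ValuedSet.{u} minimum}

/-- The partial morphism that a morphism out of `Y ⊗ X` defines at an element of `X`. -/
def slice (h : Y ⊗ X ⟶ Z) (x : X.carrier) : PartialHom Y Z where
  extent := X.eq x x
  toHom := Hom.mkOfMinimum (fun y z => Hom.rel h (y, x) z)
    (fun y z => Hom.le_left h (y, x) z)
    (fun y z => Hom.le_right h (y, x) z)
    (fun y y' => Hom.rel_inf_eq_left_le h (y, x) (y', x))
    (fun y => Hom.rel_inf_eq_right_le h (y, x))
    (fun y => Hom.rel_inf_rel_le h (y, x))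
    (fun y => Hom.eq_self_le_iSup h (y, x))

lemma eq_le_eq_slice (h : Y ⊗ X ⟶ Z) (x x' : X.carrier) :
    X.eq x x' ≤ PartialHom.eq (slice h x) (slice h x') := by
  have key (x x' : X.carrier) (y : Y.carrier) (z : Z.carrier) :
      Hom.rel h (y, x) z ⊓ X.eq x x' ≤ Hom.rel h (y, x') z :=
    (le_inf inf_le_left
      (le_inf (inf_le_left.trans ((Hom.le_left h (y, x) z).trans inf_le_left)) inf_le_right)).trans
      (Hom.rel_inf_eq_left_le h (y, x) (y, x') z)
  refine PartialHom.le_eq ⟨X.eq_le_left x x', X.eq_le_right x x', fun y z => ?_⟩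
  refine le_antisymm (le_inf (key x x' y z) inf_le_right) (le_inf ?_ inf_le_right)
  rw [X.symm]
  exact key x' x y z

/-- Currying. -/
noncomputable def curry (h : Y ⊗ X ⟶ Z) : X ⟶ exp Y Z :=
  Hom.ofFun (slice h)
    (fun x => isRetract_minimum (PartialHom.eq_self (slice h x)).ge) (eq_le_eq_slice h)

/-- Evaluation of partial morphisms. -/
noncomputable def eval (Y Z : ValuedSet.{u} minimum) : Y ⊗ exp Y Z ⟶ Z :=
  Hom.mkOfMinimum (fun a z => PartialHom.rel a.2 a.1 z)
    (fun ⟨y, F⟩ z => le_inf (F.rel_le_eq_left y z)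
      ((F.rel_le_extent y z).trans (PartialHom.eq_self F).ge))
    (fun ⟨y, F⟩ z => F.toHom.le_right y z)
    (fun ⟨y, F⟩ ⟨y', G⟩ z =>
      (le_inf ((inf_le_inf_left _ inf_le_right).trans (PartialHom.rel_inf_eq_le_rel F G y z))
        (inf_le_right.trans inf_le_left)).trans (G.rel_inf_eq_left_le y y' z))
    (fun ⟨y, F⟩ => F.toHom.rel_inf_eq_right_le y)
    (fun ⟨y, F⟩ => F.toHom.rel_inf_rel_le y)
    (fun ⟨y, F⟩ => (inf_le_inf_left _ (PartialHom.eq_self F).le).trans (F.toHom.eq_self_le_iSup y))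

lemma whiskerLeft_rel {X' : ValuedSet.{u} minimum} (k : X ⟶ X') (y y' : Y.carrier) (x : X.carrier)
    (x' : X'.carrier) : Hom.rel (Y ◁ k) (y, x) (y', x') = Y.eq y y' ⊓ Hom.rel k x x' := by
  have hw : Y ◁ k = prodLift (prodFst Y X) (prodSnd Y X ≫ k) :=
    CartesianMonoidalCategory.hom_ext _ _
      ((whiskerLeft_fst Y k).trans (prodLift_fst _ _).symm)
      ((whiskerLeft_snd Y k).trans (prodLift_snd _ _).symm)
  have hk : Hom.rel (prodSnd Y X ≫ k) (y, x) x' = (Y.eq y y ⊓ X.eq x x) ⊓ Hom.rel k x x' :=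
    Hom.ofFun_comp_rel (X := prod Y X) (Y := X) Prod.snd _ _ k (y, x) x'
  rw [hw]
  change ((Y.eq y y ⊓ X.eq x x) ⊓ Y.eq y y') ⊓ Hom.rel (prodSnd Y X ≫ k) (y, x) x' = _
  rw [hk, ← inf_inf_distrib_left, inf_eq_right]
  exact inf_le_inf (Y.eq_le_left y y') (Hom.le_left k x x')

lemma whiskerLeft_comp_eval_rel (k : X ⟶ exp Y Z) (y : Y.carrier) (x : X.carrier)
    (z : Z.carrier) :
    Hom.rel (Y ◁ k ≫ eval Y Z) (y, x) z = ⨆ F : PartialHom Y Z, Hom.rel k x F ⊓ F.rel y z := by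
  refine (Hom.comp_rel _ _ _ _).trans
    (le_antisymm (iSup_le fun ⟨y', F⟩ => ?_) (iSup_le fun F => ?_))
  · refine le_trans ?_ (le_iSup _ F)
    refine (inf_le_inf_right (F.rel y' z) (whiskerLeft_rel k y y' x F).le).trans ?_
    refine le_inf (inf_le_left.trans inf_le_right) (le_trans ?_ (F.rel_inf_eq_left_le y' y z))
    rw [Y.symm y' y]
    exact le_inf inf_le_right (inf_le_left.trans inf_le_left)
  · refine le_trans ?_ (le_iSup _ (y, F))
    refine le_trans ?_ (inf_le_inf_right (F.rel y z) (whiskerLeft_rel k y y x F).ge)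
    exact le_inf (le_inf (inf_le_right.trans (F.rel_le_eq_left y z)) inf_le_left) inf_le_right

lemma whiskerLeft_curry_comp_eval (h : Y ⊗ X ⟶ Z) : Y ◁ curry h ≫ eval Y Z = h := by
  refine Hom.eq_of_rel_le fun ⟨y, x⟩ z => ?_
  refine (whiskerLeft_comp_eval_rel (curry h) y x z).trans_le (iSup_le fun F => ?_)
  have h_eq : Hom.rel (curry h) x F ≤ PartialHom.eq F (slice h x) :=
    inf_le_right.trans (PartialHom.eq_comm _ _).le
  exact (le_inf inf_le_right (inf_le_left.trans h_eq)).trans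
    (PartialHom.rel_inf_eq_le_rel F (slice h x) y z)

lemma curry_whiskerLeft_comp_eval (k : X ⟶ exp Y Z) : curry (Y ◁ k ≫ eval Y Z) = k := by
  refine (Hom.eq_of_rel_le fun x F => ?_).symm
  refine le_inf (Hom.le_left k x F) (PartialHom.le_eq ⟨Hom.le_left k x F, ?_, fun y z => ?_⟩)
  · exact (Hom.le_right k x F).trans (PartialHom.eq_self F).le
  · refine (congrArg (· ⊓ Hom.rel k x F) (whiskerLeft_comp_eval_rel k y x z)).trans ?_
    refine le_antisymm (le_inf ?_ inf_le_right) (le_inf ?_ inf_le_right)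
    · rw [iSup_inf_eq]
      refine iSup_le fun G => ?_
      have h_eq : Hom.rel k x G ⊓ Hom.rel k x F ≤ PartialHom.eq G F := Hom.rel_inf_rel_le k x G F
      exact (le_inf (inf_le_left.trans inf_le_right)
        ((inf_le_inf_right _ inf_le_left).trans h_eq)).trans (G.rel_inf_eq_le_rel F y z)
    · rw [inf_comm]
      exact le_iSup (fun G : PartialHom Y Z => Hom.rel k x G ⊓ G.rel y z) F

/-- The currying equivalence. -/
noncomputable def curryEquiv (X Y Z : ValuedSet.{u} minimum) : (Y ⊗ X ⟶ Z) ≃ (X ⟶ exp Y Z) where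
  toFun := curry
  invFun k := Y ◁ k ≫ eval Y Z
  left_inv := whiskerLeft_curry_comp_eval
  right_inv := curry_whiskerLeft_comp_eval

end exp

open MonoidalCategory in
theorem isCartesianClosed_minimum : IsCartesianClosed (ValuedSet.{u} minimum) := by
  refine ⟨inferInstance, ⟨⟨fun Y => ⟨_, Adjunction.adjunctionOfEquivRight
    (F := MonoidalCategory.tensorLeft Y) (G_obj := exp Y) (fun X Z => curryEquiv X Y Z) ?_⟩⟩⟩⟩
  intro X' X Z f g
  refine (curryEquiv X' Y Z).symm.injective ((Equiv.symm_apply_apply _ _).trans ?_)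
  change Y ◁ f ≫ g = Y ◁ (f ≫ curry g) ≫ eval Y Z
  rw [MonoidalCategory.whiskerLeft_comp, Category.assoc, whiskerLeft_curry_comp_eval]

end minimum

end ValuedSet

theorem mainTheorem1 (T : ContinuousTNorm) :
    IsCartesianClosed (ValuedSet.{u} T) ↔ T = ContinuousTNorm.minimum := by
  constructor
  · rintro ⟨_, ⟨_⟩⟩
    exact T.eq_minimum_of_square_le_cube fun p => ValuedSet.square_le_cube p
  · rintro rfl
    exact ValuedSet.isCartesianClosed_minimum
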